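/- **Probability/fidelity tradeoff curve.** Let $H$ be a finite-dimensional complex Hilbert space and let $\psi_\pm,\varphi_\pm\in H$ be unit vectors with $s:=|\langle\psi_+|\psi_-\rangle|<1$, $t:=|\langle\varphi_+|\varphi_-\rangle|$ and $t\le s$. For a quantum operation (completely positive, trace-non-increasing linear map) $\mathcal E$ on operators of $H$ put $p_\pm=\operatorname{Tr}\mathcal E(|\psi_\pm\rangle\langle\psi_\pm|)$ and, if $p_\pm>0$, $\rho_\pm=\mathcal E(|\psi_\pm\rangle\langle\psi_\pm|)/p_\pm$; its worst-case probability is $p=\min\{p_+,p_-\}$ and its worst-case fidelity is $F=\min\{F(|\varphi_+\rangle\langle\varphi_+|,\rho_+),F(|\varphi_-\rangle\langle\varphi_-|,\rho_-)\}$, where $F(\rho,\sigma)=\operatorname{Tr}\sqrt{\sqrt\rho\,\sigma\sqrt\rho}$. Let $\mathcal A$ be the set of all pairs $(p,F)$ obtained from quantum operations with $p_\pm>0$, and let its frontier be the set of elements of $\mathcal A$ that are maximal for the componentwise order. Put $$p_0=\frac{1-s}{1-t},\qquad F(p)=\cos\left[\frac{\arccos t-\arccos\left(1-\frac{1-s}{p}\right)}{2}\right].$$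 1. $0<p_0\le1$, the function $F$ is continuous on $[p_0,1]$, and the frontier of $\mathcal A$ is exactly $\{(p,F(p)):p_0\le p\le1\}$. Every pair in $\mathcal A$ is dominated componentwise by a pair on the frontier, and for every $p\in[p_0,1]$ the number $F(p)$ is the greatest $F$ with $(p,F)\in\mathcal A$. Moreover $F(p_0)=1$. 2. For orthonormal $e_0,e_1\in H$ call two pure states a *symmetric pair* if, up to phases, they are $\cos\frac\theta2\,e_0\pm\sin\frac\theta2\,e_1$ for some $\theta\in[0,\pi/2]$, with the upper sign for the first state (so on the Bloch sphere they are mirror images about the axis $e_0$ on the great circle through $e_0$ and $e_1$). There are a unitary $V$ on $H$ and orthonormal $e_0,e_1$ for which both $(\varphi_+,\varphi_-)$ and $(V\psi_+,V\psi_-)$ are symmetric pairs. For every such $V,e_0,e_1$, writing $f_0:=|\langle V\psi_+|\varphi_+\rangle|$, we have $f_0=|\langle V\psi_-|\varphi_-\rangle|=F(1)$, so that the frontier curve runs from $(1,f_0)$ to $(p_0,1)$. Moreover for every $p\in[p_0,1]$ there are a quantum operation $\mathcal E$ and a symmetric pair of pure states $\xi_\pm$, with $\xi_+$ on the great-circle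 arc between $V\psi_+$ and $\varphi_+$ and $\xi_-$ on the arc between $V\psi_-$ and $\varphi_-$, such that $\mathcal E(|\psi_\pm\rangle\langle\psi_\pm|)=p\,|\xi_\pm\rangle\langle\xi_\pm|$, the pair of figures of merit of $\mathcal E$ is $(p,F(p))$, and $\mathcal E$ is symmetric: with $\sigma=2|e_0\rangle\langle e_0|-1$ one has $\mathcal E(V^\dagger\sigma\rho\sigma V)=\sigma\,\mathcal E(V^\dagger\rho V)\,\sigma$ for every operator $\rho$ on $H$. -/

import Mathlib

open scoped CStarAlgebra

noncomputable section

namespace ProbFid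

variable {H : Type*} [NormedAddCommGroup H] [InnerProductSpace ℂ H] [CompleteSpace H]

/-- The operator `|v⟩⟨v|`; for a unit vector `v` this is the pure state of `v`. -/
def ketbra (v : H) : H →L[ℂ] H := InnerProductSpace.rankOne ℂ v v

/-- The (real part of the) trace of an operator on a finite-dimensional space; the trace is real
for the positive operators to which this is applied. -/
def tr (A : H →L[ℂ] H) : ℝ := (LinearMap.trace ℂ H (A : H →ₗ[ℂ] H)).re

/-- A quantum operation: a completely positive map that does not increase the trace. -/
def IsQuantumOperation (E : (H →L[ℂ] H) →CP (H →L[ℂ] H)) : Prop :=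
  ∀ ρ : H →L[ℂ] H, 0 ≤ ρ → tr (E ρ) ≤ tr ρ

/-- The Uhlmann fidelity `Tr √(√ρ σ √ρ)`. -/
def fidelity (ρ σ : H →L[ℂ] H) : ℝ :=
  tr (CFC.sqrt (CFC.sqrt ρ * σ * CFC.sqrt ρ))

/-- The probability `Tr E(|ψ⟩⟨ψ|)` that the operation `E` occurs on the state `ψ`. -/
def successProb (E : (H →L[ℂ] H) →CP (H →L[ℂ] H)) (ψ : H) : ℝ := tr (E (ketbra ψ))

/-- The normalized output `E(|ψ⟩⟨ψ|) / Tr E(|ψ⟩⟨ψ|)`; used only for positive success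
probability. -/
def outputState (E : (H →L[ℂ] H) →CP (H →L[ℂ] H)) (ψ : H) : H →L[ℂ] H :=
  (((successProb E ψ)⁻¹ : ℝ) : ℂ) • E (ketbra ψ)

/-- Worst-case probability over the two inputs. -/
def worstProb (E : (H →L[ℂ] H) →CP (H →L[ℂ] H)) (ψp ψm : H) : ℝ :=
  min (successProb E ψp) (successProb E ψm)

/-- Worst-case fidelity of the two outputs with the two targets. -/
def worstFidelity (E : (H →L[ℂ] H) →CP (H →L[ℂ] H)) (ψp ψm φp φm : H) : ℝ :=
  min (fidelity (ketbra φp) (outputState E ψp)) (fidelity (ketbra φm) (outputState E ψm))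

/-- The permitted pairs `(p, F)`. Both success probabilities have to be positive, since otherwise
the corresponding output state is undefined. -/
def permitted (ψp ψm φp φm : H) : Set (ℝ × ℝ) :=
  {x | ∃ E : (H →L[ℂ] H) →CP (H →L[ℂ] H), IsQuantumOperation E ∧
    0 < successProb E ψp ∧ 0 < successProb E ψm ∧
    x = (worstProb E ψp ψm, worstFidelity E ψp ψm φp φm)}

/-- The frontier: the permitted pairs in which no figure of merit can be increased without
decreasing the other one (`Maximal` is taken in the componentwise order of `ℝ × ℝ`). -/
def frontierPairs (ψp ψm φp φm : H) : Set (ℝ × ℝ) :=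
  {x | Maximal (fun y => y ∈ permitted ψp ψm φp φm) x}

/-- `cos[(arccos t - arccos(1 - (1 - s) / p)) / 2]`. -/
def tradeoffCurve (s t p : ℝ) : ℝ :=
  Real.cos ((Real.arccos t - Real.arccos (1 - (1 - s) / p)) / 2)

/-- The pure state with Bloch angle `θ` from the axis `e₀`, on the great circle of the Bloch
sphere that consists of the real combinations of `e₀` and `e₁`. -/
def blochVec (e₀ e₁ : H) (θ : ℝ) : H :=
  ((Real.cos (θ / 2) : ℝ) : ℂ) • e₀ + ((Real.sin (θ / 2) : ℝ) : ℂ) • e₁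

/-- `χp` and `χm` are, as states, mirror images of each other on the great circle through `e₀`
and `e₁`, at Bloch angles `θ` and `-θ` from the symmetry axis `e₀`, with `θ ≤ π / 2`, so that `e₀`
is the midpoint of the pair. -/
def IsSymmetricPair (e₀ e₁ χp χm : H) : Prop :=
  ∃ θ : ℝ, 0 ≤ θ ∧ θ ≤ Real.pi / 2 ∧
    ketbra χp = ketbra (blochVec e₀ e₁ θ) ∧ ketbra χm = ketbra (blochVec e₀ e₁ (-θ))

/-- The unitary `V` brings the pair `ψp, ψm` into the symmetric configuration with the pair
`φp, φm`: coplanar in the Bloch ball, with the same symmetry axis `e₀`, and with the state of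
`V ψp` (`V ψm`) on the side of `φp` (`φm`). -/
structure IsSymmetricPlacement (V : H ≃ₗᵢ[ℂ] H) (e₀ e₁ ψp ψm φp φm : H) : Prop where
  norm_fst : ‖e₀‖ = 1
  norm_snd : ‖e₁‖ = 1
  orthogonal : inner ℂ e₀ e₁ = 0
  target : IsSymmetricPair e₀ e₁ φp φm
  initial : IsSymmetricPair e₀ e₁ (V ψp) (V ψm)

/-- The state `ξ` lies on the (shortest) great-circle arc of pure states between the states of
`χ` and `φ`: after a choice of phase `ω` for which `⟨χ, ω φ⟩ ≥ 0`, it is the state of a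
combination of `χ` and `ω φ` with nonnegative coefficients. -/
def OnArc (χ φ ξ : H) : Prop :=
  ∃ (ω : ℂ) (a b : ℝ), ‖ω‖ = 1 ∧ inner ℂ χ (ω • φ) = ((‖inner ℂ χ φ‖ : ℝ) : ℂ) ∧
    0 ≤ a ∧ 0 ≤ b ∧ ketbra ξ = ketbra ((a : ℂ) • χ + (b : ℂ) • ω • φ)

/-- The reflection `2|e₀⟩⟨e₀| - 1`. On the span of `e₀, e₁` it is `diag(1, -1)`, the rotation by
`π` of the Bloch ball about the symmetry axis `e₀`. -/
def axisReflection (e₀ : H) : H →L[ℂ] H := (2 : ℂ) • ketbra e₀ - 1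

/-- The operator `V† A V`. -/
def unconj (V : H ≃ₗᵢ[ℂ] H) (A : H →L[ℂ] H) : H →L[ℂ] H :=
  (V.symm.toContinuousLinearEquiv : H →L[ℂ] H) * A * (V.toContinuousLinearEquiv : H →L[ℂ] H)

/-- `E` is symmetric: as an operation on the rotated inputs `V ρ V†`, it commutes with the mirror
symmetry `A ↦ σ A σ` about the axis `e₀`. -/
def IsSymmetricOperation (E : (H →L[ℂ] H) →CP (H →L[ℂ] H)) (V : H ≃ₗᵢ[ℂ] H) (e₀ : H) : Prop :=
  ∀ ρ : H →L[ℂ] H,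
    E (unconj V (axisReflection e₀ * ρ * axisReflection e₀)) =
      axisReflection e₀ * E (unconj V ρ) * axisReflection e₀

end ProbFid

end

/-!
The upper bound is a triangle inequality for angles. Complete positivity on `2 × 2` blocks
(`ProbFid.exists_factorization`) factorizes the blocks `E |ψⱼ⟩⟨ψₖ|` as `∑ᵢ Sᵢⱼ† Sᵢₖ`, and the
operators `Sᵢⱼ`, read as vectors in a Hilbert–Schmidt space, give vectors `x₊, x₋` whose Gram matrix
consists of the traces of these blocks (`ProbFid.exists_gram_vectors`). Thus `‖x±‖² = p±`, and the
component `w±` of `x±` in the direction of `φ±` makes with `x±` an angle whose cosine is the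
fidelity with the target. Two such components make an angle of at least `arccos t`, while trace
non-increase on superpositions of `ψ₊` and `ψ₋` (`ProbFid.sq_sub_trace_le`) bounds the angle between
`x₊` and `x₋` by `arccos (1 - (1 - s) / p)` (`ProbFid.one_sub_div_min_le`). Along `w₊, x₊, x₋, w₋`
the triangle inequality yields `arccos t ≤ 2 arccos F + arccos (1 - (1 - s) / p)`
(`ProbFid.worst_bounds`).

The bound is attained by a single Kraus operator (`ProbFid.exists_symmetric_operation`): in the
symmetric placement, the filter `diag(a, 1)` on `e₀, e₁` turns the Bloch angles `± arccos s` of the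
two inputs into `± arccos (1 - (1 - s) / p)` and succeeds with probability `p` on both, so that it
moves both states along the arcs towards their targets, which have Bloch angles `± arccos t`. The
curve is strictly decreasing on `[p₀, 1]` and equal to `1` at `p₀`, so its points are exactly the
maximal permitted pairs.
-/

namespace ProbFid

variable {H : Type*} [NormedAddCommGroup H] [InnerProductSpace ℂ H]

open InnerProductSpace (rankOne)

/-! ### Operators of rank one and the fidelity with a pure state -/

lemma tr_ketbra [FiniteDimensional ℂ H] (v : H) : tr (ketbra v) = ‖v‖ ^ 2 := by
  simp only [tr, ketbra]
  rw [InnerProductSpace.trace_rankOne, inner_self_eq_norm_sq_to_K]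
  norm_cast

lemma tr_smul (c : ℝ) (A : H →L[ℂ] H) : tr ((c : ℂ) • A) = c * tr A := by
  simp [tr]

lemma tr_add (A B : H →L[ℂ] H) : tr (A + B) = tr A + tr B := by
  simp [tr]

lemma ketbra_smul (c : ℂ) (v : H) : ketbra (c • v) = ((‖c‖ ^ 2 : ℝ) : ℂ) • ketbra v := by
  ext x
  simp only [ketbra, InnerProductSpace.rankOne_apply, inner_smul_left,
    smul_apply, smul_smul]
  congr 1
  have := Complex.conj_mul' c
  push_cast
  rw [← this]; ring

lemma ketbra_smul_of_norm_eq_one {c : ℂ} (hc : ‖c‖ = 1) (v : H) : ketbra (c • v) = ketbra v := by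
  simp [ketbra_smul, hc]

lemma ketbra_nonneg (v : H) : 0 ≤ ketbra v := by
  rw [ContinuousLinearMap.nonneg_iff_isPositive]
  exact InnerProductSpace.isPositive_rankOne_self v

lemma smul_ketbra_nonneg (v : H) {c : ℝ} (hc : 0 ≤ c) : 0 ≤ (c : ℂ) • ketbra v := by
  have h : (c : ℂ) • ketbra v = ketbra (((√c : ℝ) : ℂ) • v) := by
    rw [ketbra_smul, Complex.norm_real, Real.norm_eq_abs, sq_abs, Real.sq_sqrt hc]
  rw [h]
  exact ketbra_nonneg _

lemma sqrt_smul_ketbra [CompleteSpace H] {φ : H} (hφ : ‖φ‖ = 1) {c : ℝ} (hc : 0 ≤ c) :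
    CFC.sqrt (((c ^ 2 : ℝ) : ℂ) • ketbra φ) = (c : ℂ) • ketbra φ := by
  refine CFC.sqrt_unique ?_ (smul_ketbra_nonneg φ hc)
  ext x
  simp only [ketbra, mul_apply_eq_comp, smul_apply,
    InnerProductSpace.rankOne_apply, inner_smul_right, inner_self_eq_norm_sq_to_K, hφ, smul_smul]
  congr 1
  push_cast; ring

/-- Against a pure target the Uhlmann fidelity is `√⟨φ, σ φ⟩`. -/
lemma fidelity_ketbra [FiniteDimensional ℂ H] [CompleteSpace H] {φ : H} (hφ : ‖φ‖ = 1)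
    (σ : H →L[ℂ] H) {c : ℝ} (hc : 0 ≤ c)
    (h : inner ℂ φ (σ φ) = ((c ^ 2 : ℝ) : ℂ)) : fidelity (ketbra φ) σ = c := by
  have h1 : CFC.sqrt (ketbra φ) = ketbra φ := by
    simpa using sqrt_smul_ketbra hφ zero_le_one
  have h2 : ketbra φ * σ * ketbra φ = ((c ^ 2 : ℝ) : ℂ) • ketbra φ := by
    ext x
    simp only [ketbra, mul_apply_eq_comp, smul_apply,
      InnerProductSpace.rankOne_apply, map_smul, h, smul_smul]
    congr 1
    ring
  rw [fidelity, h1, h2, sqrt_smul_ketbra hφ hc, tr_smul, tr_ketbra, hφ]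
  simp

/-! ### Gram vectors of a completely positive map -/

/-- Stated for a variable `A` so that it applies to `CStarMatrix` algebras, where the instances of
the continuous functional calculus are not found by direct synthesis. -/
lemma exists_eq_star_mul_self {A : Type*} [NonUnitalCStarAlgebra A] [PartialOrder A]
    [StarOrderedRing A] {a : A} (ha : 0 ≤ a) : ∃ b, a = star b * b :=
  CStarAlgebra.nonneg_iff_eq_star_mul_self.mp ha

/-- Complete positivity on `2 × 2` blocks, in factorized form. The block matrix of the
`|ψ j⟩⟨ψ k|` is `R† R`, where the first row of `R` is `|ψ 0⟩⟨ψ j|` and the second one vanishes; this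
is where `ψ 0` has to be a unit vector. -/
lemma exists_factorization [CompleteSpace H] (E : (H →L[ℂ] H) →CP (H →L[ℂ] H)) (ψ : Fin 2 → H)
    (h0 : ‖ψ 0‖ = 1) : ∃ S : Fin 2 → Fin 2 → (H →L[ℂ] H), ∀ j k,
      E (rankOne ℂ (ψ j) (ψ k)) = ∑ i, star (S i j) * S i k := by
  let R : CStarMatrix (Fin 2) (Fin 2) (H →L[ℂ] H) :=
    CStarMatrix.ofMatrix fun i j => if i = 0 then rankOne ℂ (ψ 0) (ψ j) else 0
  have hR := E.map_cstarMatrix_nonneg (star R * R) (star_mul_self_nonneg R)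
  obtain ⟨S, hS⟩ := exists_eq_star_mul_self hR
  refine ⟨fun i j => S i j, fun j k => ?_⟩
  have h := congrFun (congrFun hS j) k
  have r0 (l : Fin 2) : R 0 l = rankOne ℂ (ψ 0) (ψ l) := rfl
  have r1 (l : Fin 2) : R 1 l = 0 := rfl
  have e1 : (star R * R) j k = rankOne ℂ (ψ j) (ψ k) := by
    rw [CStarMatrix.mul_apply, Fin.sum_univ_two, CStarMatrix.star_apply, CStarMatrix.star_apply,
      r0, r0, r1, r1]
    ext x
    simp [ContinuousLinearMap.star_eq_adjoint, InnerProductSpace.adjoint_rankOne,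
      h0]
  rw [CStarMatrix.map_apply, e1, CStarMatrix.mul_apply] at h
  rw [h]
  exact Finset.sum_congr rfl fun i _ => by rw [CStarMatrix.star_apply]

/-- Vectors that represent the action of a completely positive map `E` on two pure states `ψ j`,
relative to targets `φ j`: the Gram matrix of the `x j` consists of the traces of the blocks
`E |ψ j⟩⟨ψ k|`, and `w j` is the component of `x j` in the direction of the target `φ j`. -/
lemma exists_gram_vectors [FiniteDimensional ℂ H] [CompleteSpace H]
    (E : (H →L[ℂ] H) →CP (H →L[ℂ] H)) (ψ φ : Fin 2 → H)
    (h0 : ‖ψ 0‖ = 1) (hφ : ∀ j, ‖φ j‖ = 1) :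
    ∃ x w : Fin 2 → PiLp 2 (fun _ : Fin 2 × Fin (Module.finrank ℂ H) => H),
      (∀ j k, (inner ℂ (x j) (x k) : ℂ) =
        LinearMap.trace ℂ H (E (rankOne ℂ (ψ j) (ψ k)) : H →L[ℂ] H)) ∧
      (∀ j, (inner ℂ (φ j) (E (ketbra (ψ j)) (φ j)) : ℂ) = ((‖w j‖ ^ 2 : ℝ) : ℂ)) ∧
      (∀ j, (inner ℂ (w j) (x j) : ℂ) = ((‖w j‖ ^ 2 : ℝ) : ℂ)) ∧
      ‖(inner ℂ (w 0) (w 1) : ℂ)‖ ≤ ‖(inner ℂ (φ 0) (φ 1) : ℂ)‖ * (‖w 0‖ * ‖w 1‖) := by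
  obtain ⟨S, hS⟩ := exists_factorization E ψ h0
  let b := stdOrthonormalBasis ℂ H
  have hmat (j k : Fin 2) (u v : H) :
      inner ℂ u (E (rankOne ℂ (ψ j) (ψ k)) v) = ∑ i, inner ℂ (S i j u) (S i k v) := by
    rw [hS, sum_apply, inner_sum]
    refine Finset.sum_congr rfl fun i _ => ?_
    rw [mul_apply_eq_comp, ContinuousLinearMap.star_eq_adjoint,
      ContinuousLinearMap.adjoint_inner_right]
  let x (j : Fin 2) : PiLp 2 (fun _ : Fin 2 × Fin (Module.finrank ℂ H) => H) :=
    WithLp.toLp 2 fun q => S q.1 j (b q.2)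
  let w (j : Fin 2) : PiLp 2 (fun _ : Fin 2 × Fin (Module.finrank ℂ H) => H) :=
    WithLp.toLp 2 fun q => (inner ℂ (φ j) (b q.2) : ℂ) • S q.1 j (φ j)
  have hww (j k : Fin 2) : (inner ℂ (w j) (w k) : ℂ) =
      inner ℂ (φ k) (φ j) * ∑ i, inner ℂ (S i j (φ j)) (S i k (φ k)) := by
    rw [PiLp.inner_apply, Fintype.sum_prod_type, ← b.sum_inner_mul_inner, Finset.mul_sum]
    refine Finset.sum_congr rfl fun i _ => ?_
    rw [Finset.sum_mul]
    refine Finset.sum_congr rfl fun l _ => ?_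
    simp only [w, inner_smul_left, inner_smul_right, inner_conj_symm]
    ring
  have hwn (j : Fin 2) :
      ((‖w j‖ ^ 2 : ℝ) : ℂ) = ∑ i, inner ℂ (S i j (φ j)) (S i j (φ j)) := by
    have h := hww j j
    rw [inner_self_eq_norm_sq_to_K, inner_self_eq_norm_sq_to_K, hφ] at h
    push_cast
    simpa using h
  have hwn' (j : Fin 2) :
      ‖w j‖ = ‖(WithLp.toLp 2 fun i => S i j (φ j) : PiLp 2 fun _ : Fin 2 => H)‖ := by
    rw [← sq_eq_sq₀ (norm_nonneg _) (norm_nonneg _), ← Complex.ofReal_inj, hwn]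
    have h := inner_self_eq_norm_sq_to_K (𝕜 := ℂ)
      (WithLp.toLp 2 fun i => S i j (φ j) : PiLp 2 fun _ : Fin 2 => H)
    rw [PiLp.inner_apply] at h
    push_cast
    exact h
  refine ⟨x, w, fun j k => ?_, fun j => ?_, fun j => ?_, ?_⟩
  · rw [LinearMap.trace_eq_sum_inner _ b, PiLp.inner_apply, Fintype.sum_prod_type,
      Finset.sum_comm]
    exact Finset.sum_congr rfl fun l _ => (hmat j k _ _).symm
  · rw [hwn, ← hmat]; rfl
  · rw [hwn, PiLp.inner_apply, Fintype.sum_prod_type]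
    refine Finset.sum_congr rfl fun i _ => ?_
    have hφb : S i j (φ j) = ∑ l, (inner ℂ (b l) (φ j) : ℂ) • S i j (b l) := by
      simpa using congrArg (S i j) (b.sum_repr' (φ j)).symm
    conv_rhs => arg 3; rw [hφb]
    rw [inner_sum]
    refine Finset.sum_congr rfl fun l _ => ?_
    simp only [x, w, inner_smul_left, inner_smul_right, inner_conj_symm]
  · rw [hww, norm_mul, norm_inner_symm, hwn', hwn', ← norm_inner_symm]
    refine mul_le_mul_of_nonneg_left ?_ (norm_nonneg _)
    simpa [PiLp.inner_apply] using norm_inner_le_norm (𝕜 := ℂ)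
      (WithLp.toLp 2 fun i => S i 0 (φ 0) : PiLp 2 fun _ : Fin 2 => H)
      (WithLp.toLp 2 fun i => S i 1 (φ 1))

/-! ### The upper bound on the fidelity -/

lemma exists_phase (χ φ : H) :
    ∃ ω : ℂ, ‖ω‖ = 1 ∧ inner ℂ χ (ω • φ) = ((‖(inner ℂ χ φ : ℂ)‖ : ℝ) : ℂ) := by
  obtain ⟨ω, h1, h2⟩ := RCLike.exists_norm_eq_mul_self (inner ℂ χ φ : ℂ)
  exact ⟨ω, h1, by rw [inner_smul_right, ← h2]; rfl⟩

/-- The triangle inequality for the angles along `w₀, x₀, x₁, w₁`, where `w₀, w₁` make an angle of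
at least `arccos t` and `x₀, x₁` an angle of at most `arccos c`: the larger of the two angles
between `wⱼ` and `xⱼ` is at least half of the difference. -/
lemma le_cos_of_angles {G : Type*} [NormedAddCommGroup G] [InnerProductSpace ℂ G]
    {x₀ x₁ w₀ w₁ : G} {t c F : ℝ} (hx₀ : x₀ ≠ 0) (hx₁ : x₁ ≠ 0)
    (hw₀ : (inner ℂ w₀ x₀ : ℂ) = ((‖w₀‖ ^ 2 : ℝ) : ℂ))
    (hw₁ : (inner ℂ w₁ x₁ : ℂ) = ((‖w₁‖ ^ 2 : ℝ) : ℂ))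
    (hw : ‖(inner ℂ w₀ w₁ : ℂ)‖ ≤ t * (‖w₀‖ * ‖w₁‖))
    (hc : c ≤ (inner ℂ x₀ x₁ : ℂ).re / (‖x₀‖ * ‖x₁‖)) (htc : t ≤ c)
    (hF₀ : F ≤ ‖w₀‖ / ‖x₀‖) (hF₁ : F ≤ ‖w₁‖ / ‖x₁‖) (hF1 : F ≤ 1) :
    F ≤ Real.cos ((Real.arccos t - Real.arccos c) / 2) := by
  let _ : InnerProductSpace ℝ G := InnerProductSpace.complexToReal
  have hre (a b : G) : (inner ℝ a b : ℝ) = (inner ℂ a b : ℂ).re := real_inner_eq_re_inner ℂ a b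
  have hac : Real.arccos c ≤ Real.arccos t := Real.arccos_le_arccos htc
  have ht' := Real.arccos_le_pi t
  have hc' := Real.arccos_nonneg c
  rcases le_or_gt F 0 with hF | hF
  · exact hF.trans (Real.cos_nonneg_of_mem_Icc ⟨by linarith, by linarith⟩)
  have hn₀ : 0 < ‖x₀‖ := norm_pos_iff.mpr hx₀
  have hn₁ : 0 < ‖x₁‖ := norm_pos_iff.mpr hx₁
  -- the angle with a zero vector is `π / 2`, so the cosines below need nonzero components
  have hv₀ : 0 < ‖w₀‖ := by
    by_contra h
    have : ‖w₀‖ = 0 := le_antisymm (not_lt.mp h) (norm_nonneg _)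
    rw [this, zero_div] at hF₀; linarith
  have hv₁ : 0 < ‖w₁‖ := by
    by_contra h
    have : ‖w₁‖ = 0 := le_antisymm (not_lt.mp h) (norm_nonneg _)
    rw [this, zero_div] at hF₁; linarith
  have a₀ : InnerProductGeometry.angle w₀ x₀ ≤ Real.arccos F := by
    refine Real.arccos_le_arccos (hF₀.trans_eq ?_)
    rw [hre, hw₀, Complex.ofReal_re]
    field_simp
  have a₁ : InnerProductGeometry.angle w₁ x₁ ≤ Real.arccos F := by
    refine Real.arccos_le_arccos (hF₁.trans_eq ?_)
    rw [hre, hw₁, Complex.ofReal_re]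
    field_simp
  have ax : InnerProductGeometry.angle x₀ x₁ ≤ Real.arccos c :=
    Real.arccos_le_arccos (by rw [hre]; exact hc)
  have aw : Real.arccos t ≤ InnerProductGeometry.angle w₀ w₁ := by
    refine Real.arccos_le_arccos ?_
    rw [hre, div_le_iff₀ (by positivity)]
    exact (Complex.re_le_norm _).trans hw
  have h1 := InnerProductGeometry.angle_le_angle_add_angle w₀ x₀ w₁
  have h2 := InnerProductGeometry.angle_le_angle_add_angle x₀ x₁ w₁
  rw [InnerProductGeometry.angle_comm x₁ w₁] at h2
  calc F = Real.cos (Real.arccos F) := (Real.cos_arccos (by linarith) hF1).symm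
    _ ≤ _ := Real.cos_le_cos_of_nonneg_of_le_pi (by linarith) (Real.arccos_le_pi F) (by linarith)

/-- An operation cannot increase the trace of any superposition `|v⟩⟨v|`, `v = α ψ + β χ`; by
positivity of the resulting quadratic form the off-diagonal trace is controlled by the losses of
probability. -/
lemma sq_sub_trace_le [FiniteDimensional ℂ H] [CompleteSpace H]
    {E : (H →L[ℂ] H) →CP (H →L[ℂ] H)} (hE : IsQuantumOperation E) {ψ χ : H} (hψ : ‖ψ‖ = 1)
    (hχ : ‖χ‖ = 1) {s c : ℝ} (hs : (inner ℂ ψ χ : ℂ) = (s : ℂ))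
    (hc : tr (E (rankOne ℂ ψ χ)) = c) (hc' : tr (E (rankOne ℂ χ ψ)) = c) :
    (s - c) ^ 2 ≤ (1 - successProb E ψ) * (1 - successProb E χ) := by
  have key (α : ℝ) : 0 ≤ (1 - successProb E ψ) * (α * α) + 2 * (s - c) * α
      + (1 - successProb E χ) := by
    have h := hE (ketbra ((α : ℂ) • ψ + χ)) (ketbra_nonneg _)
    have hn : ‖(α : ℂ) • ψ + χ‖ ^ 2 = α ^ 2 + 2 * α * s + 1 := by
      rw [norm_add_sq (𝕜 := ℂ), inner_smul_left, hs, norm_smul, hψ, hχ]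
      simp
      ring
    have hk : ketbra ((α : ℂ) • ψ + χ) = ((α ^ 2 : ℝ) : ℂ) • ketbra ψ +
        (α : ℂ) • rankOne ℂ ψ χ + (α : ℂ) • rankOne ℂ χ ψ + ketbra χ := by
      simp only [ketbra, map_add, map_smulₛₗ, add_apply, smul_apply, RingHom.id_apply,
        Complex.conj_ofReal, smul_add, smul_smul]
      push_cast
      rw [pow_two]
      abel
    rw [tr_ketbra, hn, hk] at h
    simp only [map_add, map_smul, tr_add, tr_smul, hc, hc'] at h
    unfold successProb
    nlinarith
  have h := discrim_le_zero key
  unfold discrim at h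
  nlinarith

/-- With success probabilities `X²`, `Y²` and off-diagonal trace `c`, the cosine `c / (X * Y)` of
the angle between the representing vectors is, for a given smaller probability, least in the
balanced case `X = Y`; the reason is `(1 - X²) (1 - Y²) ≤ (1 - X Y)²`. -/
lemma one_sub_div_min_le {X Y s c : ℝ} (hX : 0 < X) (hY : 0 < Y) (hX1 : X ^ 2 ≤ 1)
    (hY1 : Y ^ 2 ≤ 1) (hs : s ≤ 1) (h : (s - c) ^ 2 ≤ (1 - X ^ 2) * (1 - Y ^ 2)) :
    1 - (1 - s) / min (X ^ 2) (Y ^ 2) ≤ c / (X * Y) := by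
  have hXY : X * Y ≤ 1 := by nlinarith [sq_nonneg (X - Y)]
  have h1 : s - c ≤ 1 - X * Y := by
    refine le_of_abs_le (abs_le_of_sq_le_sq (h.trans ?_) (by linarith))
    nlinarith [sq_nonneg (X - Y)]
  have h2 : min (X ^ 2) (Y ^ 2) ≤ X * Y := by
    rcases le_total X Y with hle | hle
    · exact (min_le_left _ _).trans (by nlinarith)
    · exact (min_le_right _ _).trans (by nlinarith)
  have h3 : (1 - s) / (X * Y) ≤ (1 - s) / min (X ^ 2) (Y ^ 2) :=
    div_le_div_of_nonneg_left (by linarith) (by positivity) h2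
  have h4 : 1 - (1 - s) / (X * Y) ≤ c / (X * Y) := by
    have : c / (X * Y) - (1 - (1 - s) / (X * Y)) = (1 - X * Y - (s - c)) / (X * Y) := by
      field_simp; ring
    rw [← sub_nonneg, this]
    exact div_nonneg (by linarith) (by positivity)
  linarith

lemma fidelity_outputState [FiniteDimensional ℂ H] [CompleteSpace H]
    (E : (H →L[ℂ] H) →CP (H →L[ℂ] H)) {ψ φ : H} (hφ : ‖φ‖ = 1) {X W : ℝ} (hX : 0 ≤ X) (hW : 0 ≤ W)
    (hp : successProb E ψ = X ^ 2)
    (hw : (inner ℂ φ (E (ketbra ψ) φ) : ℂ) = ((W ^ 2 : ℝ) : ℂ)) :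
    fidelity (ketbra φ) (outputState E ψ) = W / X := by
  refine fidelity_ketbra hφ _ (by positivity) ?_
  rw [outputState, smul_apply, inner_smul_right, hw, hp, div_pow]
  push_cast
  ring

/-- The figures of merit of an operation: the condition on the overlap of the targets says that the
worst-case probability is at least `(1 - s) / (1 - t)`, and then the fidelity obeys the curve. -/
lemma worst_bounds [FiniteDimensional ℂ H] [CompleteSpace H]
    {ψp ψm φp φm : H} (hψp : ‖ψp‖ = 1) (hψm : ‖ψm‖ = 1) (hφp : ‖φp‖ = 1) (hφm : ‖φm‖ = 1)
    {E : (H →L[ℂ] H) →CP (H →L[ℂ] H)} (hE : IsQuantumOperation E)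
    (h₀ : 0 < successProb E ψp) (h₁ : 0 < successProb E ψm) :
    worstProb E ψp ψm ≤ 1 ∧ worstFidelity E ψp ψm φp φm ≤ 1 ∧
      (‖(inner ℂ φp φm : ℂ)‖ ≤ 1 - (1 - ‖(inner ℂ ψp ψm : ℂ)‖) / worstProb E ψp ψm →
        worstFidelity E ψp ψm φp φm ≤
          tradeoffCurve ‖(inner ℂ ψp ψm : ℂ)‖ ‖(inner ℂ φp φm : ℂ)‖ (worstProb E ψp ψm)) := by
  -- a phase that makes the overlap of the inputs equal to `s` changes neither input state
  obtain ⟨ω, hω, hin⟩ := exists_phase ψp ψm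
  have hk : ketbra (ω • ψm) = ketbra ψm := ketbra_smul_of_norm_eq_one hω ψm
  have hχ : ‖ω • ψm‖ = 1 := by rw [norm_smul, hω, hψm, one_mul]
  obtain ⟨x, w, hx, hwE, hwx, hww⟩ := exists_gram_vectors E ![ψp, ω • ψm] ![φp, φm] hψp
    (by intro j; fin_cases j; exacts [hφp, hφm])
  have hre (j k) : (inner ℂ (x j) (x k) : ℂ).re =
      tr (E (rankOne ℂ (![ψp, ω • ψm] j) (![ψp, ω • ψm] k))) := congrArg Complex.re (hx j k)
  have hX : successProb E ψp = ‖x 0‖ ^ 2 := by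
    have h := hre 0 0
    rw [inner_self_eq_norm_sq_to_K] at h
    refine h.symm.trans ?_
    norm_cast
  have hY : successProb E ψm = ‖x 1‖ ^ 2 := by
    have h := hre 1 1
    rw [inner_self_eq_norm_sq_to_K] at h
    rw [successProb, ← hk]
    refine h.symm.trans ?_
    norm_cast
  have hsm : successProb E (ω • ψm) = successProb E ψm := by rw [successProb, hk, successProb]
  have hX0 : 0 < ‖x 0‖ := by
    refine lt_of_le_of_ne (norm_nonneg _) fun h => ?_
    rw [hX, ← h] at h₀; norm_num at h₀
  have hY0 : 0 < ‖x 1‖ := by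
    refine lt_of_le_of_ne (norm_nonneg _) fun h => ?_
    rw [hY, ← h] at h₁; norm_num at h₁
  have hle {ψ : H} (hψ : ‖ψ‖ = 1) : successProb E ψ ≤ 1 := by
    have := hE _ (ketbra_nonneg ψ)
    rwa [tr_ketbra, hψ, one_pow] at this
  have hFp : fidelity (ketbra φp) (outputState E ψp) = ‖w 0‖ / ‖x 0‖ :=
    fidelity_outputState E hφp (norm_nonneg _) (norm_nonneg _) hX (hwE 0)
  have hFm : fidelity (ketbra φm) (outputState E ψm) = ‖w 1‖ / ‖x 1‖ :=
    fidelity_outputState E hφm (norm_nonneg _) (norm_nonneg _) hY (by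
      have := hwE 1
      simp only [Matrix.cons_val_one, Matrix.cons_val_fin_one, hk] at this
      exact this)
  have hF1 : worstFidelity E ψp ψm φp φm ≤ 1 := by
    refine (min_le_left _ _).trans ?_
    rw [hFp, div_le_one hX0]
    have h1 := norm_inner_le_norm (𝕜 := ℂ) (w 0) (x 0)
    rw [hwx 0, Complex.norm_real, Real.norm_of_nonneg (by positivity)] at h1
    nlinarith [norm_nonneg (w 0)]
  refine ⟨(min_le_left _ _).trans (hle hψp), hF1, fun ht => ?_⟩
  have hs1 : ‖(inner ℂ ψp ψm : ℂ)‖ ≤ 1 := by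
    simpa [hψp, hψm] using norm_inner_le_norm (𝕜 := ℂ) ψp ψm
  have hsq := sq_sub_trace_le hE hψp hχ hin (c := (inner ℂ (x 0) (x 1) : ℂ).re) (hre 0 1).symm
    (by rw [← Complex.conj_re, inner_conj_symm]; exact (hre 1 0).symm)
  rw [hsm, hX, hY] at hsq
  have hc := one_sub_div_min_le hX0 hY0 (hX ▸ hle hψp) (hY ▸ hle hψm) hs1 hsq
  rw [← hX, ← hY] at hc
  exact le_cos_of_angles (norm_pos_iff.mp hX0) (norm_pos_iff.mp hY0) (hwx 0) (hwx 1) hww hc ht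
    ((min_le_left _ _).trans_eq hFp) ((min_le_right _ _).trans_eq hFm) hF1

/-! ### The tradeoff curve -/

lemma le_one_sub_div_iff {s t p : ℝ} (ht : t < 1) (hp : 0 < p) :
    t ≤ 1 - (1 - s) / p ↔ (1 - s) / (1 - t) ≤ p := by
  rw [le_sub_comm, div_le_iff₀ hp, div_le_iff₀ (by linarith), mul_comm]

lemma one_sub_div_le {s p : ℝ} (hs : s < 1) (hp : 0 < p) (hp1 : p ≤ 1) : 1 - (1 - s) / p ≤ s := by
  have : 1 - s ≤ (1 - s) / p := by rw [le_div_iff₀ hp]; nlinarith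
  linarith

lemma tradeoffCurve_left {s t : ℝ} (hs : s < 1) :
    tradeoffCurve s t ((1 - s) / (1 - t)) = 1 := by
  have h1 : 1 - s ≠ 0 := by linarith
  have : 1 - (1 - s) / ((1 - s) / (1 - t)) = t := by
    rw [div_div_cancel₀ h1]; ring
  rw [tradeoffCurve, this, sub_self, zero_div, Real.cos_zero]

lemma tradeoffCurve_one (s t : ℝ) :
    tradeoffCurve s t 1 = Real.cos ((Real.arccos t - Real.arccos s) / 2) := by
  simp [tradeoffCurve]

lemma continuousOn_tradeoffCurve (s t : ℝ) {a b : ℝ} (ha : 0 < a) :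
    ContinuousOn (tradeoffCurve s t) (Set.Icc a b) := by
  refine Real.continuous_cos.comp_continuousOn (ContinuousOn.div_const ?_ 2)
  refine continuousOn_const.sub (Real.continuous_arccos.comp_continuousOn ?_)
  exact continuousOn_const.sub (continuousOn_const.div continuousOn_id fun p hp =>
    (ha.trans_le hp.1).ne')

lemma strictAntiOn_tradeoffCurve {s t : ℝ} (ht0 : 0 ≤ t) (hts : t ≤ s) (hs : s < 1) :
    StrictAntiOn (tradeoffCurve s t) (Set.Icc ((1 - s) / (1 - t)) 1) := by
  have hp0 : 0 < (1 - s) / (1 - t) := div_pos (by linarith) (by linarith)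
  intro p hp q hq hpq
  have hp' := hp0.trans_le hp.1
  have hq' := hp0.trans_le hq.1
  have h1 := (le_one_sub_div_iff (s := s) (hts.trans_lt hs) hp').mpr hp.1
  have h2 := one_sub_div_le hs hq' hq.2
  have h3 : 1 - (1 - s) / p < 1 - (1 - s) / q := by
    have := div_lt_div_of_pos_left (sub_pos.mpr hs) hp' hpq
    linarith
  have h4 := Real.arccos_lt_arccos (by linarith) h3 (by linarith)
  have h5 := Real.arccos_le_arccos h1
  have h6 := Real.arccos_nonneg (1 - (1 - s) / q)
  have h7 := Real.arccos_le_pi t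
  exact Real.cos_lt_cos_of_nonneg_of_le_pi (by linarith) (by linarith) (by linarith)

/-! ### Pairs of states on a great circle -/

/-- Proportionality of the states of two unit vectors, with the phase as a witness. -/
lemma exists_phase_of_ketbra_eq {χ v : H} (hχ : ‖χ‖ = 1) (hv : ‖v‖ = 1)
    (h : ketbra χ = ketbra v) : ∃ α : ℂ, ‖α‖ = 1 ∧ χ = α • v := by
  have h1 : χ = (inner ℂ v χ : ℂ) • v := by
    have h2 := congrArg (fun A : H →L[ℂ] H => A χ) h
    simpa [ketbra, inner_self_eq_norm_sq_to_K, hχ] using h2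
  refine ⟨_, ?_, h1⟩
  have := congrArg norm h1
  rwa [norm_smul, hχ, hv, mul_one, eq_comm] at this

lemma inner_blochVec {e₀ e₁ : H} (h₀ : ‖e₀‖ = 1) (h₁ : ‖e₁‖ = 1) (h : inner ℂ e₀ e₁ = (0 : ℂ))
    (θ η : ℝ) : (inner ℂ (blochVec e₀ e₁ θ) (blochVec e₀ e₁ η) : ℂ) =
      ((Real.cos ((θ - η) / 2) : ℝ) : ℂ) := by
  have h' : inner ℂ e₁ e₀ = (0 : ℂ) := by rw [← inner_conj_symm, h, map_zero]
  simp only [blochVec, inner_add_left, inner_add_right, inner_smul_left, inner_smul_right, h, h',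
    inner_self_eq_norm_sq_to_K, h₀, h₁, Complex.conj_ofReal]
  rw [show (θ - η) / 2 = θ / 2 - η / 2 by ring, Real.cos_sub]
  push_cast
  ring

lemma norm_blochVec {e₀ e₁ : H} (h₀ : ‖e₀‖ = 1) (h₁ : ‖e₁‖ = 1) (h : inner ℂ e₀ e₁ = (0 : ℂ))
    (θ : ℝ) : ‖blochVec e₀ e₁ θ‖ = 1 := by
  have h2 : ‖blochVec e₀ e₁ θ‖ ^ 2 = 1 := by
    rw [norm_sq_eq_re_inner (𝕜 := ℂ), inner_blochVec h₀ h₁ h]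
    simp
  exact (pow_eq_one_iff_of_nonneg (norm_nonneg _) two_ne_zero).mp h2

lemma blochVec_neg (e₀ e₁ : H) (θ : ℝ) : blochVec e₀ e₁ (-θ) = blochVec e₀ (-e₁) θ := by
  simp [blochVec, neg_div]

/-- The overlap of two pure states depends on the states only. -/
lemma norm_inner_eq_of_ketbra_eq {χ φ u v : H} (hχ : ‖χ‖ = 1) (hφ : ‖φ‖ = 1) (hu : ‖u‖ = 1)
    (hv : ‖v‖ = 1) (h₁ : ketbra χ = ketbra u) (h₂ : ketbra φ = ketbra v) :
    ‖(inner ℂ χ φ : ℂ)‖ = ‖(inner ℂ u v : ℂ)‖ := by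
  obtain ⟨α, hα, rfl⟩ := exists_phase_of_ketbra_eq hχ hu h₁
  obtain ⟨β, hβ, rfl⟩ := exists_phase_of_ketbra_eq hφ hv h₂
  simp [hα, hβ]

lemma OnArc.of_ketbra_eq {χ φ ξ u v : H} (hχ : ‖χ‖ = 1) (hφ : ‖φ‖ = 1) (hu : ‖u‖ = 1)
    (hv : ‖v‖ = 1) (h₁ : ketbra χ = ketbra u) (h₂ : ketbra φ = ketbra v) {r a b : ℝ} (hr : 0 ≤ r)
    (huv : (inner ℂ u v : ℂ) = (r : ℂ)) (ha : 0 ≤ a) (hb : 0 ≤ b)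
    (hξ : ketbra ξ = ketbra ((a : ℂ) • u + (b : ℂ) • v)) : OnArc χ φ ξ := by
  obtain ⟨α, hα, rfl⟩ := exists_phase_of_ketbra_eq hχ hu h₁
  obtain ⟨β, hβ, rfl⟩ := exists_phase_of_ketbra_eq hφ hv h₂
  have hαα : (starRingEnd ℂ) α * α = 1 := by rw [Complex.conj_mul', hα]; norm_num
  have hββ : (starRingEnd ℂ) β * β = 1 := by rw [Complex.conj_mul', hβ]; norm_num
  have hs : (α * (starRingEnd ℂ) β) • β • v = α • v := by
    rw [smul_smul, mul_assoc, hββ, mul_one]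
  refine ⟨α * (starRingEnd ℂ) β, a, b, by simp [hα, hβ], ?_, ha, hb, ?_⟩
  · rw [hs]
    simp only [inner_smul_left, inner_smul_right, huv, norm_mul, RCLike.norm_conj, hα, hβ,
      Complex.norm_real, Real.norm_of_nonneg hr, one_mul]
    rw [mul_left_comm, ← mul_assoc, hαα, one_mul]
  · rw [hs, hξ, smul_comm _ α, smul_comm _ α, ← smul_add, ketbra_smul_of_norm_eq_one hα]

/-- A state at an intermediate Bloch angle lies on the arc; the coefficients come from
`sin (z - x) · b(y) = sin (z - y) · b(x) + sin (y - x) · b(z)` for half angles. -/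
lemma onArc_blochVec {e₀ e₁ χ φ : H} (h₀ : ‖e₀‖ = 1) (h₁ : ‖e₁‖ = 1)
    (h : inner ℂ e₀ e₁ = (0 : ℂ)) (hχ : ‖χ‖ = 1) (hφ : ‖φ‖ = 1) {x y z : ℝ} (hx : 0 ≤ x)
    (hxy : x ≤ y) (hyz : y ≤ z) (hz : z ≤ Real.pi)
    (hχx : ketbra χ = ketbra (blochVec e₀ e₁ x)) (hφz : ketbra φ = ketbra (blochVec e₀ e₁ z)) :
    OnArc χ φ (blochVec e₀ e₁ y) := by
  have hn := norm_blochVec h₀ h₁ h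
  have hr : 0 ≤ Real.cos ((x - z) / 2) :=
    Real.cos_nonneg_of_mem_Icc ⟨by linarith, by linarith [Real.pi_pos]⟩
  have hin := inner_blochVec h₀ h₁ h x z
  rcases (hxy.trans hyz).eq_or_lt with hxz | hxz
  · obtain rfl : x = y := le_antisymm hxy (hxz ▸ hyz)
    exact .of_ketbra_eq hχ hφ (hn x) (hn z) hχx hφz hr hin zero_le_one le_rfl (by simp)
  · have hS : 0 < Real.sin ((z - x) / 2) :=
      Real.sin_pos_of_pos_of_lt_pi (by linarith) (by linarith [Real.pi_pos])
    refine .of_ketbra_eq hχ hφ (hn x) (hn z) hχx hφz hr hin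
      (a := Real.sin ((z - y) / 2) / Real.sin ((z - x) / 2))
      (b := Real.sin ((y - x) / 2) / Real.sin ((z - x) / 2))
      (div_nonneg (Real.sin_nonneg_of_nonneg_of_le_pi (by linarith) (by linarith)) hS.le)
      (div_nonneg (Real.sin_nonneg_of_nonneg_of_le_pi (by linarith) (by linarith)) hS.le) ?_
    congr 1
    have e (u v : ℝ) : Real.sin ((u - v) / 2) = Real.sin (u / 2) * Real.cos (v / 2)
        - Real.cos (u / 2) * Real.sin (v / 2) := by
      rw [← Real.sin_sub]; congr 1; ring
    have c1 : Real.cos (y / 2) = Real.sin ((z - y) / 2) / Real.sin ((z - x) / 2) *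
        Real.cos (x / 2) + Real.sin ((y - x) / 2) / Real.sin ((z - x) / 2) * Real.cos (z / 2) := by
      rw [div_mul_eq_mul_div, div_mul_eq_mul_div, ← add_div, eq_div_iff hS.ne', e, e, e]; ring
    have c2 : Real.sin (y / 2) = Real.sin ((z - y) / 2) / Real.sin ((z - x) / 2) *
        Real.sin (x / 2) + Real.sin ((y - x) / 2) / Real.sin ((z - x) / 2) * Real.sin (z / 2) := by
      rw [div_mul_eq_mul_div, div_mul_eq_mul_div, ← add_div, eq_div_iff hS.ne', e, e, e]; ring
    simp only [blochVec]
    rw [c1, c2]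
    push_cast
    module

lemma angle_eq_arccos {e₀ e₁ χ φ : H} (h₀ : ‖e₀‖ = 1) (h₁ : ‖e₁‖ = 1)
    (h : inner ℂ e₀ e₁ = (0 : ℂ)) (hχ : ‖χ‖ = 1) (hφ : ‖φ‖ = 1) {θ : ℝ} (hθ0 : 0 ≤ θ)
    (hθ : θ ≤ Real.pi / 2) (hp : ketbra χ = ketbra (blochVec e₀ e₁ θ))
    (hm : ketbra φ = ketbra (blochVec e₀ e₁ (-θ))) :
    θ = Real.arccos ‖(inner ℂ χ φ : ℂ)‖ := by
  have hn := norm_blochVec h₀ h₁ h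
  rw [norm_inner_eq_of_ketbra_eq hχ hφ (hn _) (hn _) hp hm, inner_blochVec h₀ h₁ h,
    Complex.norm_real, show (θ - -θ) / 2 = θ by ring, Real.norm_of_nonneg
      (Real.cos_nonneg_of_mem_Icc ⟨by linarith, hθ⟩), Real.arccos_cos hθ0 (by linarith)]

/-- The axis of a symmetric pair is spanned by the sum of the two vectors, after a choice of phase
that makes their inner product nonnegative; the difference spans the orthogonal direction. -/
lemma exists_frame {χ φ : H} (hχ : ‖χ‖ = 1) (hφ : ‖φ‖ = 1) (ht : ‖(inner ℂ χ φ : ℂ)‖ < 1) :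
    ∃ e₀ e₁ : H, ‖e₀‖ = 1 ∧ ‖e₁‖ = 1 ∧ inner ℂ e₀ e₁ = (0 : ℂ) ∧
      IsSymmetricPair e₀ e₁ χ φ := by
  obtain ⟨ω, hω, hin⟩ := exists_phase χ φ
  set t := ‖(inner ℂ χ φ : ℂ)‖ with ht_def
  have ht0 : 0 ≤ t := norm_nonneg _
  have hφ' : ‖ω • φ‖ = 1 := by rw [norm_smul, hω, hφ, one_mul]
  have hk : ketbra (ω • φ) = ketbra φ := ketbra_smul_of_norm_eq_one hω φ
  set φ' := ω • φ
  have hin' : inner ℂ φ' χ = (t : ℂ) := by rw [← inner_conj_symm, hin, Complex.conj_ofReal]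
  set θ := Real.arccos t with hθ
  have hθpos : 0 < θ := Real.arccos_pos.mpr ht
  have hθle : θ ≤ Real.pi / 2 := Real.arccos_le_pi_div_two.mpr ht0
  have hcosθ : Real.cos θ = t := Real.cos_arccos (by linarith) ht.le
  have hC : 0 < Real.cos (θ / 2) :=
    Real.cos_pos_of_mem_Ioo ⟨by linarith, by linarith⟩
  have hS : 0 < Real.sin (θ / 2) := Real.sin_pos_of_pos_of_lt_pi (by linarith) (by linarith)
  have hC2 : Real.cos (θ / 2) ^ 2 = (1 + t) / 2 := by
    rw [Real.cos_sq, mul_div_cancel₀ _ two_ne_zero, hcosθ]; ring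
  have hS2 : Real.sin (θ / 2) ^ 2 = (1 - t) / 2 := by
    rw [Real.sin_sq, hC2]; ring
  set C := Real.cos (θ / 2)
  set S := Real.sin (θ / 2)
  have hCC : (C : ℂ) ≠ 0 := by exact_mod_cast hC.ne'
  have hSC : (S : ℂ) ≠ 0 := by exact_mod_cast hS.ne'
  have hadd : ‖χ + φ'‖ = 2 * C := by
    rw [← sq_eq_sq₀ (norm_nonneg _) (by positivity), norm_add_sq (𝕜 := ℂ), hin, hχ, hφ', mul_pow,
      hC2]
    simp; ring
  have hsub : ‖χ - φ'‖ = 2 * S := by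
    rw [← sq_eq_sq₀ (norm_nonneg _) (by positivity), norm_sub_sq (𝕜 := ℂ), hin, hχ, hφ', mul_pow,
      hS2]
    simp; ring
  refine ⟨((2 * C : ℝ) : ℂ)⁻¹ • (χ + φ'), ((2 * S : ℝ) : ℂ)⁻¹ • (χ - φ'), ?_, ?_, ?_, θ, hθpos.le,
    hθle, ?_, ?_⟩
  · rw [norm_smul, norm_inv, Complex.norm_real, Real.norm_of_nonneg (by positivity), hadd,
      inv_mul_cancel₀ (by positivity)]
  · rw [norm_smul, norm_inv, Complex.norm_real, Real.norm_of_nonneg (by positivity), hsub,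
      inv_mul_cancel₀ (by positivity)]
  · simp only [inner_smul_left, inner_smul_right, inner_add_left, inner_sub_right, hin, hin',
      inner_self_eq_norm_sq_to_K, hχ, hφ']
    ring
  · congr 1
    change χ = (C : ℂ) • _ + (S : ℂ) • _
    rw [smul_smul, smul_smul, Complex.ofReal_mul, Complex.ofReal_mul, Complex.ofReal_ofNat]
    have e1 : (C : ℂ) * (2 * (C : ℂ))⁻¹ = 1 / 2 := by field_simp
    have e2 : (S : ℂ) * (2 * (S : ℂ))⁻¹ = 1 / 2 := by field_simp
    rw [e1, e2]
    module
  · rw [← hk]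
    congr 1
    rw [blochVec, neg_div, Real.cos_neg, Real.sin_neg, Complex.ofReal_neg]
    change φ' = (C : ℂ) • _ + (-(S : ℂ)) • _
    rw [smul_smul, smul_smul, Complex.ofReal_mul, Complex.ofReal_mul, Complex.ofReal_ofNat]
    have e1 : (C : ℂ) * (2 * (C : ℂ))⁻¹ = 1 / 2 := by field_simp
    have e2 : -(S : ℂ) * (2 * (S : ℂ))⁻¹ = -(1 / 2) := by field_simp
    rw [e1, e2]
    module

/-- Two orthonormal pairs are related by a unitary. -/
lemma exists_unitary_of_orthonormal [FiniteDimensional ℂ H] {e₀ e₁ f₀ f₁ : H} (he₀ : ‖e₀‖ = 1)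
    (he₁ : ‖e₁‖ = 1) (he : inner ℂ e₀ e₁ = (0 : ℂ)) (hf₀ : ‖f₀‖ = 1) (hf₁ : ‖f₁‖ = 1)
    (hf : inner ℂ f₀ f₁ = (0 : ℂ)) : ∃ V : H ≃ₗᵢ[ℂ] H, V f₀ = e₀ ∧ V f₁ = e₁ := by
  have orth {u₀ u₁ : H} (h₀ : ‖u₀‖ = 1) (h₁ : ‖u₁‖ = 1) (h : inner ℂ u₀ u₁ = (0 : ℂ)) :
      Orthonormal ℂ ![u₀, u₁] := by
    have h' : inner ℂ u₁ u₀ = (0 : ℂ) := by rw [← inner_conj_symm, h, map_zero]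
    refine ⟨fun i => by fin_cases i <;> simpa, fun i j hij => ?_⟩
    fin_cases i <;> fin_cases j <;> simp_all
  have hn : 2 ≤ Module.finrank ℂ H := by
    simpa using (orth he₀ he₁ he).linearIndependent.fintype_card_le_finrank
  let g : Fin 2 → Fin (Module.finrank ℂ H) := Fin.castLE hn
  have hg : Function.Injective g := Fin.castLE_injective hn
  have basis {u : Fin 2 → H} (hu : Orthonormal ℂ u) :
      ∃ b : OrthonormalBasis (Fin (Module.finrank ℂ H)) ℂ H, ∀ i, b (g i) = u i := by
    have hext (i) : Function.extend g u 0 (g i) = u i := hg.extend_apply _ _ _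
    obtain ⟨b, hb⟩ := Orthonormal.exists_orthonormalBasis_extension_of_card_eq (𝕜 := ℂ)
      (E := H) (ι := Fin (Module.finrank ℂ H)) (by simp) (v := Function.extend g u 0)
      (s := Set.range g) (by
        convert hu.comp _ (Equiv.ofInjective g hg).symm.injective using 1
        funext ⟨_, i, rfl⟩
        rw [Function.comp_apply, Equiv.ofInjective_symm_apply]
        exact hext i)
    exact ⟨b, fun i => (hb _ ⟨i, rfl⟩).trans (hext i)⟩
  obtain ⟨b, hb⟩ := basis (orth he₀ he₁ he)
  obtain ⟨b', hb'⟩ := basis (orth hf₀ hf₁ hf)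
  refine ⟨b'.equiv b (Equiv.refl _), ?_, ?_⟩
  · have := b'.equiv_apply_basis b (Equiv.refl _) (g 0)
    rw [hb'] at this
    exact this.trans (hb 0)
  · have := b'.equiv_apply_basis b (Equiv.refl _) (g 1)
    rw [hb'] at this
    exact this.trans (hb 1)

lemma exists_isSymmetricPlacement [FiniteDimensional ℂ H] {ψp ψm φp φm : H} (hψp : ‖ψp‖ = 1)
    (hψm : ‖ψm‖ = 1) (hφp : ‖φp‖ = 1) (hφm : ‖φm‖ = 1) (hs : ‖(inner ℂ ψp ψm : ℂ)‖ < 1)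
    (ht : ‖(inner ℂ φp φm : ℂ)‖ < 1) :
    ∃ (V : H ≃ₗᵢ[ℂ] H) (e₀ e₁ : H), IsSymmetricPlacement V e₀ e₁ ψp ψm φp φm := by
  obtain ⟨e₀, e₁, he₀, he₁, he, hφ⟩ := exists_frame hφp hφm ht
  obtain ⟨f₀, f₁, hf₀, hf₁, hf, θ, hθ0, hθ, hp, hm⟩ := exists_frame hψp hψm hs
  obtain ⟨V, hV₀, hV₁⟩ := exists_unitary_of_orthonormal he₀ he₁ he hf₀ hf₁ hf
  have hV (η : ℝ) : V (blochVec f₀ f₁ η) = blochVec e₀ e₁ η := by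
    simp [blochVec, hV₀, hV₁]
  have hn := norm_blochVec hf₀ hf₁ hf
  refine ⟨V, e₀, e₁, he₀, he₁, he, hφ, θ, hθ0, hθ, ?_, ?_⟩
  · obtain ⟨α, hα, rfl⟩ := exists_phase_of_ketbra_eq hψp (hn _) hp
    rw [map_smul, hV, ketbra_smul_of_norm_eq_one hα]
  · obtain ⟨α, hα, rfl⟩ := exists_phase_of_ketbra_eq hψm (hn _) hm
    rw [map_smul, hV, ketbra_smul_of_norm_eq_one hα]

/-! ### Operations with a single Kraus operator -/

/-- The completely positive map `A ↦ K A K†`. -/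
noncomputable def krausMap [CompleteSpace H] (K : H →L[ℂ] H) : (H →L[ℂ] H) →CP (H →L[ℂ] H) where
  toFun A := K * A * star K
  map_add' A B := by rw [mul_add, add_mul]
  map_smul' c A := by simp
  map_cstarMatrix_nonneg' n M hM := by
    obtain ⟨R, rfl⟩ := exists_eq_star_mul_self hM
    let T : CStarMatrix (Fin n) (Fin n) (H →L[ℂ] H) :=
      CStarMatrix.ofMatrix fun i j => R i j * star K
    have hT (i j) : T i j = R i j * star K := rfl
    convert star_mul_self_nonneg T using 1
    refine CStarMatrix.ext fun i j => ?_
    rw [CStarMatrix.map_apply, CStarMatrix.mul_apply, CStarMatrix.mul_apply]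
    change K * _ * star K = _
    rw [Finset.mul_sum, Finset.sum_mul]
    refine Finset.sum_congr rfl fun k _ => ?_
    rw [CStarMatrix.star_apply, CStarMatrix.star_apply, hT, hT, star_mul, star_star]
    simp only [mul_assoc]

lemma krausMap_apply [CompleteSpace H] (K A : H →L[ℂ] H) : krausMap K A = K * A * star K := rfl

lemma krausMap_ketbra [CompleteSpace H] (K : H →L[ℂ] H) (v : H) :
    krausMap K (ketbra v) = ketbra (K v) := by
  ext x
  simp [krausMap_apply, ketbra, ContinuousLinearMap.star_eq_adjoint,
    ContinuousLinearMap.adjoint_inner_right]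

lemma isQuantumOperation_krausMap [FiniteDimensional ℂ H] [CompleteSpace H] {K : H →L[ℂ] H}
    (hK : ∀ v, ‖K v‖ ≤ ‖v‖) : IsQuantumOperation (krausMap K) := by
  intro ρ hρ
  rw [ContinuousLinearMap.nonneg_iff_isPositive,
    ContinuousLinearMap.isPositive_iff_eq_sum_rankOne] at hρ
  obtain ⟨m, u, rfl⟩ := hρ
  have htr (f : Fin m → H →L[ℂ] H) : tr (∑ i, f i) = ∑ i, tr (f i) := by
    simp [tr]
  rw [map_sum, htr, htr]
  refine Finset.sum_le_sum fun i _ => ?_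
  change tr (krausMap K (ketbra (u i))) ≤ tr (ketbra (u i))
  rw [krausMap_ketbra, tr_ketbra, tr_ketbra]
  exact pow_le_pow_left₀ (norm_nonneg _) (hK _) 2

/-- The filter that multiplies the amplitude of `e` by `a` and fixes the orthogonal complement. -/
noncomputable def axisFilter (e : H) (a : ℝ) : H →L[ℂ] H := 1 - ((1 - a : ℝ) : ℂ) • ketbra e

lemma norm_axisFilter_le {e : H} (he : ‖e‖ = 1) {a : ℝ} (ha0 : 0 ≤ a) (ha1 : a ≤ 1) (v : H) :
    ‖axisFilter e a v‖ ≤ ‖v‖ := by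
  have h : axisFilter e a v = v - (((1 - a : ℝ) : ℂ) * inner ℂ e v) • e := by
    simp [axisFilter, ketbra, smul_smul]
  rw [← sq_le_sq₀ (norm_nonneg _) (norm_nonneg _), h, norm_sub_sq (𝕜 := ℂ), inner_smul_right,
    norm_smul, he, norm_mul, Complex.norm_real, Real.norm_of_nonneg (by linarith), mul_assoc,
    ← inner_conj_symm v e, Complex.mul_conj', norm_inner_symm]
  have : RCLike.re (((1 - a : ℝ) : ℂ) * (‖(inner ℂ v e : ℂ)‖ : ℂ) ^ 2) =
      (1 - a) * ‖(inner ℂ v e : ℂ)‖ ^ 2 := by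
    rw [← Complex.ofReal_pow, ← Complex.ofReal_mul]; rfl
  rw [this]
  nlinarith [mul_nonneg (mul_nonneg (by linarith : 0 ≤ 1 - a) (by linarith : 0 ≤ 1 + a))
    (sq_nonneg ‖(inner ℂ v e : ℂ)‖)]

lemma axisFilter_blochVec {e₀ e₁ : H} (h₀ : ‖e₀‖ = 1) (h : inner ℂ e₀ e₁ = (0 : ℂ)) {a q θ η : ℝ}
    (hc : a * Real.cos (θ / 2) = q * Real.cos (η / 2))
    (hs : Real.sin (θ / 2) = q * Real.sin (η / 2)) :
    axisFilter e₀ a (blochVec e₀ e₁ θ) = (q : ℂ) • blochVec e₀ e₁ η := by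
  have h1 : axisFilter e₀ a (blochVec e₀ e₁ θ) =
      ((a * Real.cos (θ / 2) : ℝ) : ℂ) • e₀ + ((Real.sin (θ / 2) : ℝ) : ℂ) • e₁ := by
    simp only [axisFilter, ketbra, blochVec, sub_apply, smul_apply,
      InnerProductSpace.rankOne_apply, inner_add_right, inner_smul_right,
      inner_self_eq_norm_sq_to_K, h₀, h, one_apply_eq_self]
    push_cast
    module
  rw [h1, hc, hs, blochVec]
  push_cast
  module

lemma star_ketbra [CompleteSpace H] (v : H) : star (ketbra v) = ketbra v := by
  rw [ContinuousLinearMap.star_eq_adjoint]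
  exact InnerProductSpace.adjoint_rankOne v v

/-- Precomposition with `V` removes `V†` from the inputs, and the filter along `e` commutes with
the reflection about `e`. -/
lemma isSymmetricOperation_krausMap [CompleteSpace H] (V : H ≃ₗᵢ[ℂ] H) (e : H) (a : ℝ) :
    IsSymmetricOperation
      (krausMap (axisFilter e a * (V.toContinuousLinearEquiv : H →L[ℂ] H))) V e := by
  have hstar : star (axisFilter e a) = axisFilter e a := by
    simp [axisFilter, star_ketbra]
  have hcomm : axisFilter e a * axisReflection e = axisReflection e * axisFilter e a := by
    simp only [axisFilter, axisReflection]
    simp only [sub_mul, mul_sub, smul_mul_assoc, mul_smul_comm, one_mul, mul_one]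
    module
  have hstarV : star (V.toContinuousLinearEquiv : H →L[ℂ] H) =
      (V.symm.toContinuousLinearEquiv : H →L[ℂ] H) := V.star_eq_symm
  have hVV : (V.toContinuousLinearEquiv : H →L[ℂ] H) *
      (V.symm.toContinuousLinearEquiv : H →L[ℂ] H) = 1 := by
    ext x; simp
  have key (A : H →L[ℂ] H) :
      krausMap (axisFilter e a * (V.toContinuousLinearEquiv : H →L[ℂ] H)) (unconj V A) =
        axisFilter e a * A * axisFilter e a := by
    rw [krausMap_apply, star_mul, hstar, hstarV, unconj]
    calc _ = axisFilter e a * ((V.toContinuousLinearEquiv : H →L[ℂ] H) *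
          (V.symm.toContinuousLinearEquiv : H →L[ℂ] H)) * A *
          ((V.toContinuousLinearEquiv : H →L[ℂ] H) *
          (V.symm.toContinuousLinearEquiv : H →L[ℂ] H)) * axisFilter e a := by
            simp only [mul_assoc]
      _ = _ := by rw [hVV, mul_one, mul_one]
  intro ρ
  rw [key, key]
  calc _ = (axisFilter e a * axisReflection e) * ρ * (axisReflection e * axisFilter e a) := by
        simp only [mul_assoc]
    _ = (axisReflection e * axisFilter e a) * ρ * (axisFilter e a * axisReflection e) := by
        rw [hcomm]
    _ = _ := by simp only [mul_assoc]

/-- The half-angle identities that fix the filter: it multiplies the amplitude of the axis by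
`a ≤ 1` and leaves that of the orthogonal direction alone, so `sin (θ / 2) = √p sin (η / 2)`, which
says that `cos η = 1 - (1 - cos θ) / p`. -/
lemma exists_filter_amplitude {p s : ℝ} (hs0 : 0 ≤ s) (hp : 0 < p) (hp1 : p ≤ 1)
    (hs1 : s ≤ 1) (hc : -1 ≤ 1 - (1 - s) / p) :
    ∃ a : ℝ, 0 ≤ a ∧ a ≤ 1 ∧
      a * Real.cos (Real.arccos s / 2) = √p * Real.cos (Real.arccos (1 - (1 - s) / p) / 2) ∧
      Real.sin (Real.arccos s / 2) = √p * Real.sin (Real.arccos (1 - (1 - s) / p) / 2) := by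
  have hc1 : 1 - (1 - s) / p ≤ 1 := by
    have : 0 ≤ (1 - s) / p := div_nonneg (by linarith) hp.le
    linarith
  set η := Real.arccos (1 - (1 - s) / p) with hη
  set θ := Real.arccos s with hθ
  have hcosη : Real.cos η = 1 - (1 - s) / p := Real.cos_arccos hc hc1
  have hcosθ : Real.cos θ = s := Real.cos_arccos (by linarith) hs1
  have hη0 := Real.arccos_nonneg (1 - (1 - s) / p)
  have hηπ := Real.arccos_le_pi (1 - (1 - s) / p)
  have hθ0 := Real.arccos_nonneg s
  have hθπ : θ ≤ Real.pi / 2 := Real.arccos_le_pi_div_two.mpr hs0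
  have hCη : 0 ≤ Real.cos (η / 2) := Real.cos_nonneg_of_mem_Icc ⟨by linarith, by linarith⟩
  have hSη : 0 ≤ Real.sin (η / 2) :=
    Real.sin_nonneg_of_nonneg_of_le_pi (by linarith) (by linarith)
  have hCθ : 0 < Real.cos (θ / 2) :=
    Real.cos_pos_of_mem_Ioo ⟨by linarith [Real.pi_pos], by linarith [Real.pi_pos]⟩
  have hSθ : 0 ≤ Real.sin (θ / 2) :=
    Real.sin_nonneg_of_nonneg_of_le_pi (by linarith) (by linarith [Real.pi_pos])
  have hc2 (x : ℝ) : Real.cos (x / 2) ^ 2 = (1 + Real.cos x) / 2 := by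
    rw [Real.cos_sq, mul_div_cancel₀ _ two_ne_zero]; ring
  have hs2 (x : ℝ) : Real.sin (x / 2) ^ 2 = (1 - Real.cos x) / 2 := by
    rw [Real.sin_sq, hc2]; ring
  have hps : p * ((1 - s) / p) = 1 - s := by field_simp
  refine ⟨√p * Real.cos (η / 2) / Real.cos (θ / 2), by positivity, ?_, by field_simp, ?_⟩
  · rw [div_le_one hCθ, ← sq_le_sq₀ (by positivity) hCθ.le, mul_pow, Real.sq_sqrt hp.le, hc2, hc2,
      hcosη, hcosθ]
    linarith
  · rw [← sq_eq_sq₀ hSθ (by positivity), mul_pow, Real.sq_sqrt hp.le, hs2, hs2, hcosη, hcosθ]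
    linarith

/-! ### Optimal operations -/

lemma fidelity_ketbra_ketbra [FiniteDimensional ℂ H] [CompleteSpace H] {φ : H} (hφ : ‖φ‖ = 1)
    (ξ : H) : fidelity (ketbra φ) (ketbra ξ) = ‖(inner ℂ φ ξ : ℂ)‖ := by
  refine fidelity_ketbra hφ _ (norm_nonneg _) ?_
  rw [ketbra, InnerProductSpace.rankOne_apply, inner_smul_right, ← inner_conj_symm ξ φ,
    Complex.conj_mul']
  push_cast
  rfl

lemma successProb_of_eq [FiniteDimensional ℂ H] {E : (H →L[ℂ] H) →CP (H →L[ℂ] H)} {ψ ξ : H} {p : ℝ}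
    (hξ : ‖ξ‖ = 1) (h : E (ketbra ψ) = (p : ℂ) • ketbra ξ) : successProb E ψ = p := by
  rw [successProb, h, tr_smul, tr_ketbra, hξ]; ring

lemma outputState_of_eq [FiniteDimensional ℂ H] {E : (H →L[ℂ] H) →CP (H →L[ℂ] H)} {ψ ξ : H} {p : ℝ}
    (hp : 0 < p) (hξ : ‖ξ‖ = 1) (h : E (ketbra ψ) = (p : ℂ) • ketbra ξ) :
    outputState E ψ = ketbra ξ := by
  rw [outputState, successProb_of_eq hξ h, h, smul_smul, ← Complex.ofReal_mul,
    inv_mul_cancel₀ hp.ne', Complex.ofReal_one, one_smul]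

/-- In a symmetric placement the filter along the axis takes the initial pair, at Bloch angles
`± arccos s`, to the pair at Bloch angles `± arccos (1 - (1 - s) / p)`, with probability `p`.
The states with index `-` are treated like those with index `+`, with `-e₁` in place of `e₁`. -/
lemma exists_symmetric_operation [FiniteDimensional ℂ H] [CompleteSpace H] {ψp ψm φp φm : H}
    (hψp : ‖ψp‖ = 1) (hψm : ‖ψm‖ = 1) (hφp : ‖φp‖ = 1) (hφm : ‖φm‖ = 1) {s t : ℝ}
    (hs : s = ‖(inner ℂ ψp ψm : ℂ)‖) (ht : t = ‖(inner ℂ φp φm : ℂ)‖) (hs1 : s < 1)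
    {V : H ≃ₗᵢ[ℂ] H} {e₀ e₁ : H}
    (hV : IsSymmetricPlacement V e₀ e₁ ψp ψm φp φm) :
    (t ≤ s → tradeoffCurve s t 1 = ‖(inner ℂ (V ψp) φp : ℂ)‖ ∧
        tradeoffCurve s t 1 = ‖(inner ℂ (V ψm) φm : ℂ)‖) ∧
      ∀ p : ℝ, 0 < p → p ≤ 1 → t ≤ 1 - (1 - s) / p →
        ∃ (E : (H →L[ℂ] H) →CP (H →L[ℂ] H)) (ξp ξm : H),
          IsQuantumOperation E ∧ IsSymmetricOperation E V e₀ ∧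
          ‖ξp‖ = 1 ∧ ‖ξm‖ = 1 ∧ IsSymmetricPair e₀ e₁ ξp ξm ∧
          OnArc (V ψp) φp ξp ∧ OnArc (V ψm) φm ξm ∧
          E (ketbra ψp) = (p : ℂ) • ketbra ξp ∧
          E (ketbra ψm) = (p : ℂ) • ketbra ξm ∧
          worstProb E ψp ψm = p ∧
          worstFidelity E ψp ψm φp φm = tradeoffCurve s t p := by
  obtain ⟨h₀, h₁, h, ⟨θ, hθ0, hθ, hφpθ, hφmθ⟩, ⟨η, hη0, hη, hψpη, hψmη⟩⟩ := hV
  have h' : inner ℂ e₀ (-e₁) = (0 : ℂ) := by rw [inner_neg_right, h, neg_zero]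
  have h₁' : ‖-e₁‖ = 1 := by rw [norm_neg, h₁]
  have hVp : ‖V ψp‖ = 1 := by rw [V.norm_map, hψp]
  have hVm : ‖V ψm‖ = 1 := by rw [V.norm_map, hψm]
  have hn := norm_blochVec h₀ h₁ h
  have hn' := norm_blochVec h₀ h₁' h'
  have hs0 : 0 ≤ s := hs ▸ norm_nonneg _
  obtain rfl : θ = Real.arccos t := by
    rw [angle_eq_arccos h₀ h₁ h hφp hφm hθ0 hθ hφpθ hφmθ, ht]
  obtain rfl : η = Real.arccos s := by
    rw [angle_eq_arccos h₀ h₁ h hVp hVm hη0 hη hψpη hψmη, hs, V.inner_map_map]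
  rw [blochVec_neg] at hφmθ hψmη
  have hcos {x y : ℝ} (hx : 0 ≤ x) (hxy : x ≤ y) (hy : y ≤ Real.pi / 2) :
      0 ≤ Real.cos ((y - x) / 2) :=
    Real.cos_nonneg_of_mem_Icc ⟨by linarith [Real.pi_pos], by linarith [Real.pi_pos]⟩
  refine ⟨fun hts => ?_, fun p hp hp1 htp => ?_⟩
  · have hst := Real.arccos_le_arccos hts
    rw [tradeoffCurve_one, norm_inner_symm (V ψp), norm_inner_symm (V ψm),
      norm_inner_eq_of_ketbra_eq hφp hVp (hn _) (hn _) hφpθ hψpη,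
      norm_inner_eq_of_ketbra_eq hφm hVm (hn' _) (hn' _) hφmθ hψmη,
      inner_blochVec h₀ h₁ h, inner_blochVec h₀ h₁' h', Complex.norm_real,
      Real.norm_of_nonneg (hcos hη0 hst hθ)]
    exact ⟨rfl, rfl⟩
  · have ht0 : 0 ≤ t := ht ▸ norm_nonneg _
    have hcs := one_sub_div_le hs1 hp hp1
    obtain ⟨a, ha0, ha1, hac, has⟩ :=
      exists_filter_amplitude hs0 hp hp1 hs1.le (by linarith)
    have hζ0 := Real.arccos_nonneg (1 - (1 - s) / p)
    have hηζ := Real.arccos_le_arccos hcs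
    have hζθ := Real.arccos_le_arccos htp
    rw [tradeoffCurve]
    set ζ := Real.arccos (1 - (1 - s) / p)
    have out {f ψ : H} (hf : ‖f‖ = 1) (hef : inner ℂ e₀ f = (0 : ℂ)) (hψ : ‖V ψ‖ = 1)
        (hψη : ketbra (V ψ) = ketbra (blochVec e₀ f (Real.arccos s))) :
        krausMap (axisFilter e₀ a * (V.toContinuousLinearEquiv : H →L[ℂ] H)) (ketbra ψ) =
          (p : ℂ) • ketbra (blochVec e₀ f ζ) := by
      obtain ⟨α, hα, hαψ⟩ := exists_phase_of_ketbra_eq hψ (norm_blochVec h₀ hf hef _) hψη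
      rw [krausMap_ketbra]
      change ketbra (axisFilter e₀ a (V ψ)) = _
      rw [hαψ, map_smul, ketbra_smul_of_norm_eq_one hα, axisFilter_blochVec h₀ hef hac has,
        ketbra_smul, Complex.norm_real, Real.norm_of_nonneg (Real.sqrt_nonneg p),
        Real.sq_sqrt hp.le]
    have hEp := out h₁ h hVp hψpη
    have hEm := out h₁' h' hVm hψmη
    have hFp : fidelity (ketbra φp) (ketbra (blochVec e₀ e₁ ζ)) =
        Real.cos ((Real.arccos t - ζ) / 2) := by
      rw [hφpθ, fidelity_ketbra_ketbra (hn _), inner_blochVec h₀ h₁ h, Complex.norm_real,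
        Real.norm_of_nonneg (hcos hζ0 hζθ hθ)]
    have hFm : fidelity (ketbra φm) (ketbra (blochVec e₀ (-e₁) ζ)) =
        Real.cos ((Real.arccos t - ζ) / 2) := by
      rw [hφmθ, fidelity_ketbra_ketbra (hn' _), inner_blochVec h₀ h₁' h', Complex.norm_real,
        Real.norm_of_nonneg (hcos hζ0 hζθ hθ)]
    refine ⟨krausMap (axisFilter e₀ a * (V.toContinuousLinearEquiv : H →L[ℂ] H)),
      blochVec e₀ e₁ ζ, blochVec e₀ (-e₁) ζ, ?_, isSymmetricOperation_krausMap V e₀ a, hn _, hn' _,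
      ⟨ζ, hζ0, hζθ.trans hθ, rfl, by rw [blochVec_neg]⟩, ?_, ?_, hEp, hEm, ?_, ?_⟩
    · refine isQuantumOperation_krausMap fun v => ?_
      exact (norm_axisFilter_le h₀ ha0 ha1 (V v)).trans_eq (V.norm_map v)
    · exact onArc_blochVec h₀ h₁ h hVp hφp hη0 hηζ hζθ (by linarith [Real.pi_pos]) hψpη hφpθ
    · exact onArc_blochVec h₀ h₁' h' hVm hφm hη0 hηζ hζθ (by linarith [Real.pi_pos]) hψmη hφmθ
    · rw [worstProb, successProb_of_eq (hn _) hEp, successProb_of_eq (hn' _) hEm, min_self]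
    · rw [worstFidelity, outputState_of_eq hp (hn _) hEp, outputState_of_eq hp (hn' _) hEm, hFp,
        hFm, min_self]

end ProbFid

/-! ### The frontier -/

theorem mainTheorem2 {H : Type*} [NormedAddCommGroup H] [InnerProductSpace ℂ H]
    [FiniteDimensional ℂ H] [CompleteSpace H]
    (ψp ψm φp φm : H) (hψp : ‖ψp‖ = 1) (hψm : ‖ψm‖ = 1) (hφp : ‖φp‖ = 1) (hφm : ‖φm‖ = 1)
    (s t p₀ : ℝ) (hs : s = ‖(inner ℂ ψp ψm : ℂ)‖) (ht : t = ‖(inner ℂ φp φm : ℂ)‖)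
    (hp₀ : p₀ = (1 - s) / (1 - t)) (hs_lt : s < 1) (hts : t ≤ s) :
    -- the frontier is the graph of the curve over `[p₀, 1]`
    (0 < p₀ ∧ p₀ ≤ 1) ∧
    ProbFid.frontierPairs ψp ψm φp φm =
      (fun p : ℝ => (p, ProbFid.tradeoffCurve s t p)) '' Set.Icc p₀ 1 ∧
    ContinuousOn (ProbFid.tradeoffCurve s t) (Set.Icc p₀ 1) ∧
    -- every permitted pair is dominated by a pair on the frontier
    (∀ x ∈ ProbFid.permitted ψp ψm φp φm, ∃ y ∈ ProbFid.frontierPairs ψp ψm φp φm, x ≤ y) ∧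
    -- `F(p)` is the best fidelity at worst-case probability `p`
    (∀ p ∈ Set.Icc p₀ 1,
      IsGreatest {F : ℝ | (p, F) ∈ ProbFid.permitted ψp ψm φp φm} (ProbFid.tradeoffCurve s t p)) ∧
    -- the endpoint with unit fidelity
    ProbFid.tradeoffCurve s t p₀ = 1 ∧
    -- a symmetric placement of the initial pair exists
    (∃ (V : H ≃ₗᵢ[ℂ] H) (e₀ e₁ : H), ProbFid.IsSymmetricPlacement V e₀ e₁ ψp ψm φp φm) ∧
    -- for each such placement
    (∀ (V : H ≃ₗᵢ[ℂ] H) (e₀ e₁ : H), ProbFid.IsSymmetricPlacement V e₀ e₁ ψp ψm φp φm →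
      -- the endpoint with unit probability is `(1, f₀)`
      (ProbFid.tradeoffCurve s t 1 = ‖(inner ℂ (V ψp) φp : ℂ)‖ ∧
        ProbFid.tradeoffCurve s t 1 = ‖(inner ℂ (V ψm) φm : ℂ)‖) ∧
      -- each point of the curve is reached by a symmetric operation with outputs on the arcs
      ∀ p ∈ Set.Icc p₀ 1,
        ∃ (E : (H →L[ℂ] H) →CP (H →L[ℂ] H)) (ξp ξm : H),
          ProbFid.IsQuantumOperation E ∧ ProbFid.IsSymmetricOperation E V e₀ ∧
          ‖ξp‖ = 1 ∧ ‖ξm‖ = 1 ∧ ProbFid.IsSymmetricPair e₀ e₁ ξp ξm ∧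
          ProbFid.OnArc (V ψp) φp ξp ∧ ProbFid.OnArc (V ψm) φm ξm ∧
          E (ProbFid.ketbra ψp) = (p : ℂ) • ProbFid.ketbra ξp ∧
          E (ProbFid.ketbra ψm) = (p : ℂ) • ProbFid.ketbra ξm ∧
          ProbFid.worstProb E ψp ψm = p ∧
          ProbFid.worstFidelity E ψp ψm φp φm = ProbFid.tradeoffCurve s t p) := by
  have ht0 : 0 ≤ t := ht ▸ norm_nonneg _
  have ht1 : t < 1 := hts.trans_lt hs_lt
  have h1t : 0 < 1 - t := by linarith
  have hp₀pos : 0 < p₀ := hp₀ ▸ div_pos (by linarith) h1t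
  have hp₀1 : p₀ ≤ 1 := by rw [hp₀, div_le_one h1t]; linarith
  have hleft : ProbFid.tradeoffCurve s t p₀ = 1 := hp₀ ▸ ProbFid.tradeoffCurve_left hs_lt
  have hanti : StrictAntiOn (ProbFid.tradeoffCurve s t) (Set.Icc p₀ 1) :=
    hp₀ ▸ ProbFid.strictAntiOn_tradeoffCurve ht0 hts hs_lt
  have hmem {p : ℝ} (hp : p₀ ≤ p) : t ≤ 1 - (1 - s) / p :=
    (ProbFid.le_one_sub_div_iff ht1 (hp₀pos.trans_le hp)).mpr (hp₀ ▸ hp)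
  have hplace := ProbFid.exists_isSymmetricPlacement hψp hψm hφp hφm (hs ▸ hs_lt) (ht ▸ ht1)
  have hopt {V : H ≃ₗᵢ[ℂ] H} {e₀ e₁ : H}
      (hV : ProbFid.IsSymmetricPlacement V e₀ e₁ ψp ψm φp φm) :=
    ProbFid.exists_symmetric_operation hψp hψm hφp hφm hs ht hs_lt hV
  have hperm {p : ℝ} (hp : p ∈ Set.Icc p₀ 1) :
      (p, ProbFid.tradeoffCurve s t p) ∈ ProbFid.permitted ψp ψm φp φm := by
    obtain ⟨V, e₀, e₁, hV⟩ := hplace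
    have hpos := hp₀pos.trans_le hp.1
    obtain ⟨E, ξp, ξm, hE, -, hξp, hξm, -, -, -, hEp, hEm, hP, hF⟩ :=
      (hopt hV).2 p hpos hp.2 (hmem hp.1)
    refine ⟨E, hE, ?_, ?_, by rw [hP, hF]⟩
    · rwa [ProbFid.successProb_of_eq hξp hEp]
    · rwa [ProbFid.successProb_of_eq hξm hEm]
  have hbound {x : ℝ × ℝ} (hx : x ∈ ProbFid.permitted ψp ψm φp φm) :
      x.1 ≤ 1 ∧ x.2 ≤ 1 ∧ (p₀ ≤ x.1 → x.2 ≤ ProbFid.tradeoffCurve s t x.1) := by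
    obtain ⟨E, hE, hEp, hEm, rfl⟩ := hx
    obtain ⟨h1, h2, h3⟩ := ProbFid.worst_bounds hψp hψm hφp hφm hE hEp hEm
    rw [← hs, ← ht] at h3
    exact ⟨h1, h2, fun h => h3 (hmem h)⟩
  have hmax {p : ℝ} (hp : p ∈ Set.Icc p₀ 1) :
      (p, ProbFid.tradeoffCurve s t p) ∈ ProbFid.frontierPairs ψp ψm φp φm := by
    refine ⟨hperm hp, fun y hy hle => ?_⟩
    obtain ⟨h1, -, h3⟩ := hbound hy
    have hp₀y : p₀ ≤ y.1 := hp.1.trans hle.1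
    have hF : ProbFid.tradeoffCurve s t p ≤ ProbFid.tradeoffCurve s t y.1 := hle.2.trans (h3 hp₀y)
    have hyp : y.1 ≤ p := (hanti.le_iff_ge hp ⟨hp₀y, h1⟩).mp hF
    obtain rfl : y.1 = p := le_antisymm hyp hle.1
    exact ⟨hyp, h3 hp₀y⟩
  -- below `p₀`, the endpoint with unit fidelity dominates
  have hdom {x : ℝ × ℝ} (hx : x ∈ ProbFid.permitted ψp ψm φp φm) :
      ∃ p ∈ Set.Icc p₀ 1, x ≤ (p, ProbFid.tradeoffCurve s t p) := by
    obtain ⟨h1, h2, h3⟩ := hbound hx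
    rcases le_total p₀ x.1 with h | h
    · exact ⟨x.1, ⟨h, h1⟩, le_rfl, h3 h⟩
    · exact ⟨p₀, ⟨le_rfl, hp₀1⟩, h, h2.trans_eq hleft.symm⟩
  refine ⟨⟨hp₀pos, hp₀1⟩, ?_, ProbFid.continuousOn_tradeoffCurve s t hp₀pos, ?_, ?_, hleft,
    hplace, ?_⟩
  · refine Set.Subset.antisymm (fun x hx => ?_) ?_
    · obtain ⟨p, hp, hle⟩ := hdom hx.1
      exact ⟨p, hp, le_antisymm (hx.2 (hperm hp) hle) hle⟩
    · rintro _ ⟨p, hp, rfl⟩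
      exact hmax hp
  · intro x hx
    obtain ⟨p, hp, hle⟩ := hdom hx
    exact ⟨_, hmax hp, hle⟩
  · exact fun p hp => ⟨hperm hp, fun F hF => (hbound hF).2.2 hp.1⟩
  · exact fun V e₀ e₁ hV => ⟨(hopt hV).1 hts, fun p hp =>
      (hopt hV).2 p (hp₀pos.trans_le hp.1) hp.2 (hmem hp.1)⟩
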